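/- For complex $\alpha,\beta,\delta$ with $\operatorname{Re}\alpha>0$ let $$E^\delta_{\alpha,\beta}(z)=\sum_{n=0}^\infty \frac{(\delta)_n}{n!\,\Gamma(\alpha n+\beta)}\,z^n,\qquad (\delta)_n=\delta(\delta+1)\cdots(\delta+n-1),\quad z\in\mathbb C,$$ be the Prabhakar generalized Mittag-Leffler function (with $1/\Gamma=0$ at the poles of $\Gamma$). Let $0<\alpha<2$, $\beta>0$, $\frac{\alpha\pi}{2}<\mu<\min\{\pi,\alpha\pi\}$ and let $D>0$. Then there exists a constant $C>0$, depending only on $\mu$, $\alpha$, $\beta$ and $D$, such that for every real $\delta$ with $0<\delta\le D$ and every $z\in\mathbb C$ with $\mu\le|\arg z|\le\pi$ (principal argument) $$\left|E^\delta_{\alpha,\beta}(z)\right|\le\frac{C}{1+|z|^\delta}.$$ In particular, for every fixed $\delta>0$ the bound holds throughout this sector with a constant that does not depend on $z$. -/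

import Mathlib

/-- The Prabhakar generalized Mittag-Leffler function
`E^δ_{α,β}(z) = ∑ (δ)_n / (n! Γ(α n + β)) z^n`, with `(δ)_n = δ (δ + 1) ⋯ (δ + n - 1)`.
At a pole of `Γ` Mathlib has `Γ = 0` and `x / 0 = 0`, which is the usual convention `1 / Γ = 0`. -/
noncomputable def prabhakar (α β δ z : ℂ) : ℂ :=
  ∑' n : ℕ, (ascPochhammer ℂ n).eval δ / ((n.factorial : ℂ) * Complex.Gamma (α * n + β)) * z ^ n

/-- The defining series converges absolutely at every `z`, for real `α, β > 0` and any `δ`. -/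
theorem prabhakar_summable {α β : ℝ} (hα : 0 < α) (hβ : 0 < β) (δ z : ℂ) :
    Summable fun n : ℕ =>
      (ascPochhammer ℂ n).eval δ / ((n.factorial : ℂ) * Complex.Gamma ((α : ℂ) * n + β)) *
        z ^ n := by
  have hG : ∀ T x : ℝ, 0 < T → 1 ≤ x → Real.exp (-T) * T ^ (x - 1) ≤ Real.Gamma x := by
    intro T x hT hx
    have hi := Real.GammaIntegral_convergent (s := x) (by linarith)
    have hsub : Set.Ioi T ⊆ Set.Ioi (0 : ℝ) := Set.Ioi_subset_Ioi hT.le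
    rw [Real.Gamma_eq_integral (by linarith), ← integral_exp_neg_Ioi T,
      ← MeasureTheory.integral_mul_const]
    refine le_trans (MeasureTheory.setIntegral_mono_on
      ((integrableOn_exp_neg_Ioi T).mul_const _) (hi.mono_set hsub) measurableSet_Ioi ?_)
      (MeasureTheory.setIntegral_mono_set hi ?_ hsub.eventuallyLE)
    · intro t ht
      exact mul_le_mul_of_nonneg_left
        (Real.rpow_le_rpow hT.le (le_of_lt ht) (by linarith)) (Real.exp_pos _).le
    · refine (MeasureTheory.ae_restrict_iff' measurableSet_Ioi).2 (.of_forall fun t ht => ?_)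
      have : (0 : ℝ) < t := ht
      simp only [Pi.zero_apply]
      positivity
  have hP : ∀ n : ℕ, ‖(ascPochhammer ℂ n).eval δ‖ ≤ (‖δ‖ + 1) ^ n * n.factorial := by
    intro n
    induction n with
    | zero => simp
    | succ n ih =>
      rw [ascPochhammer_succ_eval, norm_mul, Nat.factorial_succ, pow_succ]
      have h1 : ‖δ + n‖ ≤ (‖δ‖ + 1) * (n + 1) := by
        refine (norm_add_le _ _).trans ?_
        have h2 : 0 ≤ ‖δ‖ * n := by positivity
        rw [Complex.norm_natCast]
        nlinarith
      calc _ ≤ ((‖δ‖ + 1) ^ n * n.factorial) * ((‖δ‖ + 1) * (n + 1)) := by gcongr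
        _ = _ := by push_cast; ring
  set q : ℝ := (‖δ‖ + 1) * ‖z‖ with hq
  have hq0 : 0 ≤ q := by positivity
  set T : ℝ := (2 * q + 1) ^ (1 / α) with hT
  have hT0 : 0 < T := by positivity
  have hTα : T ^ α = 2 * q + 1 := by
    rw [hT, ← Real.rpow_mul (by positivity), one_div, inv_mul_cancel₀ hα.ne', Real.rpow_one]
  have hr : q / (2 * q + 1) < 1 := by
    rw [div_lt_one (by positivity)]; linarith
  refine Summable.of_norm_bounded_eventually_nat
    (g := fun n : ℕ => Real.exp T * T ^ (1 - β) * (q / (2 * q + 1)) ^ n)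
    ((summable_geometric_of_lt_one (by positivity) hr).mul_left _) ?_
  filter_upwards [Filter.eventually_ge_atTop ⌈1 / α⌉₊] with n hn
  have hn1 : 1 ≤ α * n + β := by
    have h1 : 1 / α ≤ n := (Nat.le_ceil _).trans (by exact_mod_cast hn)
    rw [div_le_iff₀ hα] at h1
    nlinarith
  have hg := hG T _ hT0 hn1
  have hcast : Complex.Gamma ((α : ℂ) * n + β) = ((Real.Gamma (α * n + β) : ℝ) : ℂ) := by
    rw [← Complex.Gamma_ofReal]; push_cast; rfl
  have hpow : T ^ (α * n + β - 1) = (2 * q + 1) ^ n * (T ^ (1 - β))⁻¹ := by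
    rw [← hTα, ← Real.rpow_natCast, ← Real.rpow_mul hT0.le, ← Real.rpow_neg hT0.le,
      ← Real.rpow_add hT0]
    congr 1; ring
  rw [hpow] at hg
  have hΓ : 0 < Real.Gamma (α * n + β) := Real.Gamma_pos_of_pos (by linarith)
  rw [hcast, norm_mul, norm_div, norm_mul, norm_pow, Complex.norm_natCast, Complex.norm_real,
    Real.norm_of_nonneg hΓ.le]
  have hf : (0 : ℝ) < n.factorial := by positivity
  calc _ ≤ (‖δ‖ + 1) ^ n * n.factorial / (n.factorial *
          (Real.exp (-T) * ((2 * q + 1) ^ n * (T ^ (1 - β))⁻¹))) * ‖z‖ ^ n := by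
        gcongr
        exact hP n
    _ = _ := by
        rw [Real.exp_neg, div_pow, hq, mul_pow]
        field_simp

open Complex Set Filter Topology MeasureTheory

/-! For `c > 0`, Hankel's contour gives `2πi E(z) = ∫ exp s * s ^ (-β) * (1 - u) ^ (-δ) ds` with `u
= z * s ^ (-α)`, over the two rays from `c` at angles `±θ`. Any `θ` with `π/2 < θ < min π (μ/α)`
works: then `exp s` decays along the rays, and for `|arg s| ≤ θ`, `|arg z| ≥ μ` the argument of `u`
stays at least `μ - αθ > 0` away from `0` modulo `2π` (`re_mul_cpow_neg_le`). Hence `|1 - u| ≥ c₀ (1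
+ |u|)` (`norm_one_sub_ge`), so no singularity meets the sector.

The formula holds for large `c`, where `|u| ≤ 1/2` on the rays: the binomial series is integrated
term by term and each term is Hankel's integral for `1/Γ(αn + β)`. It passes to every `c > 0`
because the contour integral does not depend on `c` (`hankelIntegral_eq`).

At `c = 1` the lower bound on `|1 - u|` gives `(1 + |z|^δ) |1 - u|^(-δ) ≤ c₀^(-δ) (1 + |s|^(αδ))`.
The right side is controlled uniformly for `δ ≤ D` and grows only polynomially in `|s|`, so `exp s`
makes it integrable. -/

/-! ### Laplace transform of a real power -/

theorem integrableOn_rpow_mul_exp_neg_mul {a b : ℝ} (ha : -1 < a) (hb : 0 < b) :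
    IntegrableOn (fun t : ℝ => t ^ a * Real.exp (-b * t)) (Ioi 0) := by
  simpa using integrableOn_rpow_mul_exp_neg_mul_rpow ha (one_pos : (0 : ℝ) < 1) hb

theorem differentiableAt_laplace_rpow {a : ℝ} (ha : 0 < a) {p : ℂ} (hp : 0 < p.re) :
    DifferentiableAt ℂ
      (fun q : ℂ => ∫ t : ℝ in Ioi 0, ((t ^ (a - 1) : ℝ) : ℂ) * cexp (-(q * t))) p := by
  have hmeas : ∀ b : ℝ, ∀ q : ℂ, AEStronglyMeasurable
      (fun t : ℝ => ((t ^ b : ℝ) : ℂ) * cexp (-(q * t))) (volume.restrict (Ioi 0)) := by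
    intro b q
    refine Measurable.aestronglyMeasurable ?_
    fun_prop
  have hnorm : ∀ b : ℝ, ∀ q : ℂ, ∀ t : ℝ, 0 < t →
      ‖((t ^ b : ℝ) : ℂ) * cexp (-(q * t))‖ = t ^ b * Real.exp (-q.re * t) := by
    intro b q t ht
    rw [norm_mul, Complex.norm_real, Complex.norm_exp, Real.norm_of_nonneg (by positivity)]
    simp
  refine (hasDerivAt_integral_of_dominated_loc_of_deriv_le
    (F' := fun q t => -(((t ^ a : ℝ) : ℂ) * cexp (-(q * t))))
    (bound := fun t => t ^ a * Real.exp (-(p.re / 2) * t))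
    (Metric.ball_mem_nhds p (half_pos hp)) (.of_forall fun q => hmeas _ q) ?_ (hmeas a p).neg
    ?_ (integrableOn_rpow_mul_exp_neg_mul (by linarith) (by linarith)) ?_).2.differentiableAt
  · refine (integrableOn_rpow_mul_exp_neg_mul (a := a - 1) (by linarith) hp).mono' (hmeas _ p) ?_
    filter_upwards [ae_restrict_mem measurableSet_Ioi] with t ht
    exact (hnorm _ p t ht).le
  · filter_upwards [ae_restrict_mem measurableSet_Ioi] with t ht q hq
    have ht' : (0 : ℝ) < t := ht
    rw [norm_neg, hnorm _ q t ht]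
    have h1 : |(q - p).re| < p.re / 2 := (abs_re_le_norm _).trans_lt (by simpa [dist_eq] using hq)
    have h2 : p.re / 2 ≤ q.re := by rw [abs_lt, sub_re] at h1; linarith
    gcongr
  · filter_upwards [ae_restrict_mem measurableSet_Ioi] with t ht q _
    have ht' : (0 : ℝ) < t := ht
    have h : HasDerivAt (fun q : ℂ => ((t ^ (a - 1) : ℝ) : ℂ) * cexp (-(q * t)))
        (((t ^ (a - 1) : ℝ) : ℂ) * (cexp (-(q * t)) * -(1 * (t : ℂ)))) q :=
      (((hasDerivAt_id q).mul_const (t : ℂ)).neg.cexp).const_mul ((t ^ (a - 1) : ℝ) : ℂ)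
    refine h.congr_deriv ?_
    rw [show t ^ a = t ^ (a - 1) * t by rw [Real.rpow_sub_one ht'.ne']; field_simp]
    push_cast
    ring

/-- The Laplace transform of a real power, at a complex point of the right half plane. -/
theorem laplace_rpow {a : ℝ} (ha : 0 < a) {p : ℂ} (hp : 0 < p.re) :
    ∫ t : ℝ in Ioi 0, ((t ^ (a - 1) : ℝ) : ℂ) * cexp (-(p * t)) = p ^ (-(a : ℂ)) * Gamma a := by
  have hU : IsOpen {q : ℂ | 0 < q.re} := isOpen_lt continuous_const continuous_re
  have hf : AnalyticOnNhd ℂ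
      (fun q : ℂ => ∫ t : ℝ in Ioi 0, ((t ^ (a - 1) : ℝ) : ℂ) * cexp (-(q * t)))
      {q : ℂ | 0 < q.re} :=
    DifferentiableOn.analyticOnNhd
      (fun q hq => (differentiableAt_laplace_rpow ha hq).differentiableWithinAt) hU
  have hg : AnalyticOnNhd ℂ (fun q : ℂ => q ^ (-(a : ℂ)) * Gamma a) {q : ℂ | 0 < q.re} :=
    DifferentiableOn.analyticOnNhd (fun q hq => DifferentiableAt.differentiableWithinAt <|
      (differentiableAt_id.cpow_const (Or.inl hq)).mul_const _) hU
  -- Identity theorem on the half plane: both sides are holomorphic there and agree at the real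
  -- points near `1`.
  refine hf.eqOn_of_preconnected_of_frequently_eq hg
    (convex_halfSpace_re_gt 0).isPreconnected (z₀ := 1) (by simp) ?_ hp
  have hreal : ∀ᶠ x : ℝ in 𝓝[≠] 1,
      ∫ t : ℝ in Ioi 0, ((t ^ (a - 1) : ℝ) : ℂ) * cexp (-((x : ℂ) * t)) =
        (x : ℂ) ^ (-(a : ℂ)) * Gamma a := by
    filter_upwards [nhdsWithin_le_nhds (lt_mem_nhds one_pos)] with x hx
    have h := integral_cpow_mul_exp_neg_mul_Ioi (a := a) (by simpa) hx
    rw [cpow_neg, ← inv_cpow _ _ (by rw [arg_ofReal_of_nonneg hx.le]; exact Real.pi_pos.ne),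
      ← one_div, ← h]
    refine setIntegral_congr_fun measurableSet_Ioi fun t ht => ?_
    rw [ofReal_cpow (le_of_lt ht)]
    push_cast
    rfl
  have htend : Tendsto (fun x : ℝ => (x : ℂ)) (𝓝[≠] 1) (𝓝[≠] 1) := by
    refine tendsto_nhdsWithin_of_tendsto_nhds_of_eventually_within _ ?_ ?_
    · have h : Tendsto (fun x : ℝ => (x : ℂ)) (𝓝 1) (𝓝 ((1 : ℝ) : ℂ)) :=
        continuous_ofReal.tendsto 1
      rw [ofReal_one] at h
      exact h.mono_left nhdsWithin_le_nhds
    · filter_upwards [self_mem_nhdsWithin] with x hx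
      simpa using hx
  exact htend.frequently hreal.frequently

/-! ### Sectors and rays -/

/-- The closed sector `|arg s| ≤ θ` without its vertex. -/
def sector (θ : ℝ) : Set ℂ := {s | s ≠ 0 ∧ |arg s| ≤ θ}

/-- The ray from `c` in the direction `exp (φ i)`. -/
noncomputable def ray (c φ r : ℝ) : ℂ := c + r * cexp (φ * I)

theorem ray_re (c φ r : ℝ) : (ray c φ r).re = c + r * Real.cos φ := by
  simp [ray, exp_ofReal_mul_I_re]

theorem ray_im (c φ r : ℝ) : (ray c φ r).im = r * Real.sin φ := by
  simp [ray, exp_ofReal_mul_I_im]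

theorem ray_zero (c φ : ℝ) : ray c φ 0 = c := by simp [ray]

@[fun_prop]
theorem continuous_ray (c φ : ℝ) : Continuous (ray c φ) := by
  unfold ray; fun_prop

theorem ray_neg (c φ r : ℝ) : ray c (-φ) r = (starRingEnd ℂ) (ray c φ r) := by
  apply Complex.ext <;> simp [ray_re, ray_im]

theorem mul_abs_sin_le_norm_ray {c φ r : ℝ} (hr : 0 ≤ r) : r * |Real.sin φ| ≤ ‖ray c φ r‖ := by
  have h := abs_im_le_norm (ray c φ r)
  rwa [ray_im, abs_mul, abs_of_nonneg hr] at h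

/-- Rotation by `-φ` exchanges the starting point and the length, up to the sign of `φ`. Estimates
in `r` thereby become estimates in `c`. -/
theorem ray_mul_exp_neg (c φ r : ℝ) :
    ray c φ r * cexp ((-φ : ℝ) * I) = ray r (-φ) c := by
  rw [ray, ray, add_mul, mul_assoc, ← Complex.exp_add]
  simp [add_comm]

theorem start_mul_abs_sin_le_norm_ray {c φ r : ℝ} (hc : 0 ≤ c) :
    c * |Real.sin φ| ≤ ‖ray c φ r‖ := by
  have h := mul_abs_sin_le_norm_ray (c := r) (φ := -φ) hc
  rwa [← ray_mul_exp_neg, norm_mul, norm_exp_ofReal_mul_I, mul_one, Real.sin_neg, abs_neg] at h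

theorem abs_sin_pos {φ : ℝ} (hφ0 : φ ≠ 0) (hφ : |φ| < Real.pi) : 0 < |Real.sin φ| := by
  rw [abs_pos]
  rw [abs_lt] at hφ
  exact fun h => hφ0 ((Real.sin_eq_zero_iff_of_lt_of_lt hφ.1 hφ.2).1 h)

theorem ray_ne_zero {c φ r : ℝ} (hφ0 : φ ≠ 0) (hφ : |φ| < Real.pi) (hc : 0 ≤ c) (hr : 0 ≤ r)
    (h : 0 < c ∨ 0 < r) : ray c φ r ≠ 0 := by
  have hs := abs_sin_pos hφ0 hφ
  rw [← norm_pos_iff]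
  rcases h with h | h
  · exact (mul_pos h hs).trans_le (start_mul_abs_sin_le_norm_ray hc)
  · exact (mul_pos h hs).trans_le (mul_abs_sin_le_norm_ray hr)

theorem ray_mem_sector_of_pos {c φ r : ℝ} (hφ0 : 0 < φ) (hφ : φ < Real.pi) (hc : 0 ≤ c)
    (hr : 0 ≤ r) (h : 0 < c ∨ 0 < r) : ray c φ r ∈ sector φ := by
  have hs : 0 < Real.sin φ := Real.sin_pos_of_pos_of_lt_pi hφ0 hφ
  have hne : ray c φ r ≠ 0 :=
    ray_ne_zero hφ0.ne' (by rwa [abs_of_pos hφ0]) hc hr h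
  refine ⟨hne, ?_⟩
  have harg : 0 ≤ arg (ray c φ r) := by
    rw [arg_nonneg_iff, ray_im]
    positivity
  rw [abs_of_nonneg harg]
  -- After rotation by `-φ` the imaginary part is `-c sin φ ≤ 0`, whereas an argument in `(φ, π]`
  -- would make it positive.
  by_contra! hlt
  have h1 : (ray c φ r * cexp ((-φ : ℝ) * I)).im =
      ‖ray c φ r‖ * Real.sin (arg (ray c φ r) - φ) := by
    conv_lhs => rw [← norm_mul_exp_arg_mul_I (ray c φ r)]
    rw [mul_assoc, ← Complex.exp_add, ← add_mul, ← ofReal_add, im_ofReal_mul, exp_ofReal_mul_I_im, sub_eq_add_neg]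
  rw [ray_mul_exp_neg, ray_im, Real.sin_neg] at h1
  have h2 : 0 < ‖ray c φ r‖ * Real.sin (arg (ray c φ r) - φ) :=
    mul_pos (norm_pos_iff.2 hne) (Real.sin_pos_of_pos_of_lt_pi (by linarith)
      (by linarith [arg_le_pi (ray c φ r)]))
  nlinarith

theorem ray_mem_sector {c φ r : ℝ} (hφ0 : φ ≠ 0) (hφ : |φ| < Real.pi) (hc : 0 ≤ c) (hr : 0 ≤ r)
    (h : 0 < c ∨ 0 < r) : ray c φ r ∈ sector |φ| := by
  rcases hφ0.lt_or_gt with hneg | hpos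
  · rw [abs_of_neg hneg] at hφ ⊢
    obtain ⟨h1, h2⟩ := ray_mem_sector_of_pos (neg_pos.2 hneg) hφ hc hr h
    rw [ray_neg] at h1 h2
    refine ⟨by simpa using h1, ?_⟩
    rw [arg_conj] at h2
    split_ifs at h2 with h3
    · rwa [h3]
    · rwa [abs_neg] at h2
  · rw [abs_of_pos hpos] at hφ ⊢
    exact ray_mem_sector_of_pos hpos hφ hc hr h

theorem sector_subset_slitPlane {θ : ℝ} (hθ : θ < Real.pi) : sector θ ⊆ slitPlane := by
  intro s hs
  rw [mem_slitPlane_iff_arg]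
  refine ⟨fun h => ?_, hs.1⟩
  have := hs.2
  rw [h, abs_of_pos Real.pi_pos] at this
  linarith

/-! ### Contour integrals over rays and their independence of the vertex -/

/-- `g` is holomorphic along the sector, and `g` and `g'` are `O (exp (re s))` away from `0`. -/
structure SectorDecay (θ : ℝ) (g : ℂ → ℂ) : Prop where
  diff : ∀ s ∈ sector θ, DifferentiableAt ℂ g s
  bound : ∀ ρ > 0, ∃ K : ℝ, ∀ s ∈ sector θ, ρ ≤ ‖s‖ →
    ‖g s‖ ≤ K * Real.exp s.re ∧ ‖deriv g s‖ ≤ K * Real.exp s.re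

theorem cos_neg_of_abs {φ : ℝ} (h1 : Real.pi / 2 < |φ|) (h2 : |φ| < Real.pi) :
    Real.cos φ < 0 := by
  rw [← Real.cos_abs]
  exact Real.cos_neg_of_pi_div_two_lt_of_lt h1 (by linarith)

theorem integrableOn_exp_ray {φ : ℝ} (c : ℝ) (h1 : Real.pi / 2 < |φ|) (h2 : |φ| < Real.pi) :
    IntegrableOn (fun r => Real.exp (ray c φ r).re) (Ioi 0) := by
  have h := (exp_neg_integrableOn_Ioi 0 (neg_pos.2 (cos_neg_of_abs h1 h2))).const_mul (Real.exp c)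
  refine h.congr (.of_forall fun r => ?_)
  simp only [ray_re, Real.exp_add, neg_neg, mul_comm r]

theorem ne_zero_of_abs {φ : ℝ} (h1 : Real.pi / 2 < |φ|) : φ ≠ 0 :=
  abs_pos.1 ((half_pos Real.pi_pos).trans h1)

theorem hasDerivAt_ray (c φ r : ℝ) : HasDerivAt (ray c φ) (cexp (φ * I)) r := by
  have h := ((hasDerivAt_id r).ofReal_comp.mul_const (cexp (φ * I))).const_add (c : ℂ)
  rw [ofReal_one, one_mul] at h
  exact h

theorem hasDerivAt_ray_start (c φ r : ℝ) : HasDerivAt (fun c => ray c φ r) 1 c := by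
  have h := (hasDerivAt_id c).ofReal_comp.add_const (r * cexp (φ * I))
  simpa [ray] using h

namespace SectorDecay
variable {φ : ℝ} {g : ℂ → ℂ}

/-- All rays with start `x ≥ c` keep distance at least `c |sin φ|` from `0`, so one constant serves
them all. This uniformity in `x` permits differentiation under the integral. -/
theorem exists_bound_ray (hg : SectorDecay |φ| g) (h1 : Real.pi / 2 < |φ|) (h2 : |φ| < Real.pi)
    {c : ℝ} (hc : 0 < c) : ∃ K : ℝ, 0 ≤ K ∧ ∀ x ≥ c, ∀ r ≥ 0,
      ‖g (ray x φ r)‖ ≤ K * Real.exp (ray x φ r).re ∧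
      ‖deriv g (ray x φ r)‖ ≤ K * Real.exp (ray x φ r).re := by
  have hφ0 := ne_zero_of_abs h1
  have hs := abs_sin_pos hφ0 h2
  obtain ⟨K, hK⟩ := hg.bound (c * |Real.sin φ|) (mul_pos hc hs)
  have key : ∀ x ≥ c, ∀ r ≥ 0, ‖g (ray x φ r)‖ ≤ K * Real.exp (ray x φ r).re ∧
      ‖deriv g (ray x φ r)‖ ≤ K * Real.exp (ray x φ r).re := by
    intro x hx r hr
    have hx0 : 0 < x := hc.trans_le hx
    refine hK _ (ray_mem_sector hφ0 h2 hx0.le hr (Or.inl hx0)) ?_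
    exact (mul_le_mul_of_nonneg_right hx hs.le).trans (start_mul_abs_sin_le_norm_ray hx0.le)
  refine ⟨K, ?_, key⟩
  have := (norm_nonneg _).trans (key c le_rfl 0 le_rfl).1
  exact nonneg_of_mul_nonneg_left this (Real.exp_pos _)

theorem continuousOn_ray (hg : SectorDecay |φ| g) (h1 : Real.pi / 2 < |φ|) (h2 : |φ| < Real.pi)
    {c : ℝ} (hc : 0 < c) : ContinuousOn (fun r => g (ray c φ r)) (Ici 0) := by
  intro r hr
  exact ((hg.diff _ (ray_mem_sector (ne_zero_of_abs h1) h2 hc.le hr (Or.inl hc))).continuousAt.comp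
    (continuous_ray c φ).continuousAt).continuousWithinAt

theorem aestronglyMeasurable_ray (hg : SectorDecay |φ| g) (h1 : Real.pi / 2 < |φ|)
    (h2 : |φ| < Real.pi) {c : ℝ} (hc : 0 < c) :
    AEStronglyMeasurable (fun r => g (ray c φ r) * cexp (φ * I)) (volume.restrict (Ioi 0)) :=
  (((hg.continuousOn_ray h1 h2 hc).mono Ioi_subset_Ici_self).aestronglyMeasurable
    measurableSet_Ioi).mul_const _

theorem integrableOn_ray (hg : SectorDecay |φ| g) (h1 : Real.pi / 2 < |φ|)
    (h2 : |φ| < Real.pi) {c : ℝ} (hc : 0 < c) :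
    IntegrableOn (fun r => g (ray c φ r) * cexp (φ * I)) (Ioi 0) := by
  obtain ⟨K, -, hK⟩ := hg.exists_bound_ray h1 h2 hc
  refine ((integrableOn_exp_ray c h1 h2).const_mul K).mono'
    (hg.aestronglyMeasurable_ray h1 h2 hc) ?_
  filter_upwards [ae_restrict_mem measurableSet_Ioi] with r hr
  rw [norm_mul, norm_exp_ofReal_mul_I, mul_one]
  exact (hK c le_rfl r (le_of_lt hr)).1

theorem aestronglyMeasurable_deriv_ray (c : ℝ) :
    AEStronglyMeasurable (fun r => deriv g (ray c φ r) * cexp (φ * I))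
      (volume.restrict (Ioi 0)) :=
  (((measurable_deriv g).comp (continuous_ray c φ).measurable).mul_const _).aestronglyMeasurable

theorem integrableOn_deriv_ray (hg : SectorDecay |φ| g) (h1 : Real.pi / 2 < |φ|)
    (h2 : |φ| < Real.pi) {c : ℝ} (hc : 0 < c) :
    IntegrableOn (fun r => deriv g (ray c φ r) * cexp (φ * I)) (Ioi 0) := by
  obtain ⟨K, -, hK⟩ := hg.exists_bound_ray h1 h2 hc
  refine ((integrableOn_exp_ray c h1 h2).const_mul K).mono' (aestronglyMeasurable_deriv_ray c) ?_
  filter_upwards [ae_restrict_mem measurableSet_Ioi] with r hr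
  rw [norm_mul, norm_exp_ofReal_mul_I, mul_one]
  exact (hK c le_rfl r (le_of_lt hr)).2

theorem integral_deriv_ray (hg : SectorDecay |φ| g) (h1 : Real.pi / 2 < |φ|)
    (h2 : |φ| < Real.pi) {c : ℝ} (hc : 0 < c) :
    ∫ r in Ioi 0, deriv g (ray c φ r) * cexp (φ * I) = -g c := by
  have h := integral_Ioi_of_hasDerivAt_of_tendsto' (a := 0) (m := 0)
    (f := fun r => g (ray c φ r)) (f' := fun r => deriv g (ray c φ r) * cexp (φ * I)) ?_
    (hg.integrableOn_deriv_ray h1 h2 hc) ?_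
  · rw [h, ray_zero, zero_sub]
  · intro r hr
    exact (hg.diff _ (ray_mem_sector (ne_zero_of_abs h1) h2 hc.le hr (Or.inl hc))).hasDerivAt.comp
      r (hasDerivAt_ray c φ r)
  · obtain ⟨K, -, hK⟩ := hg.exists_bound_ray h1 h2 hc
    have hlim : Tendsto (fun r => K * Real.exp (ray c φ r).re) atTop (𝓝 (K * 0)) := by
      refine (Real.tendsto_exp_atBot.comp ?_).const_mul K
      simp only [ray_re]
      exact tendsto_atBot_add_const_left _ _
        (tendsto_id.atTop_mul_const_of_neg (cos_neg_of_abs h1 h2))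
    rw [mul_zero] at hlim
    refine squeeze_zero_norm' ?_ hlim
    filter_upwards [eventually_ge_atTop 0] with r hr
    exact (hK c le_rfl r hr).1

/-- Moving the start replaces `g` by `g'` in the integrand, and `g'` integrates along the ray to `-g
c`. This value does not involve `φ`. -/
theorem hasDerivAt_integral_ray (hg : SectorDecay |φ| g) (h1 : Real.pi / 2 < |φ|)
    (h2 : |φ| < Real.pi) {c : ℝ} (hc : 0 < c) :
    HasDerivAt (fun x : ℝ => ∫ r in Ioi 0, g (ray x φ r) * cexp (φ * I)) (-g c) c := by
  obtain ⟨K, hK0, hK⟩ := hg.exists_bound_ray h1 h2 (half_pos hc)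
  rw [← hg.integral_deriv_ray h1 h2 hc]
  have hnhds : Ioo (c / 2) (c + 1) ∈ 𝓝 c := Ioo_mem_nhds (by linarith) (by linarith)
  refine (hasDerivAt_integral_of_dominated_loc_of_deriv_le
    (F := fun x r => g (ray x φ r) * cexp (φ * I)) (F' := fun x r => deriv g (ray x φ r) * cexp (φ * I))
    (bound := fun r => K * Real.exp (ray (c + 1) φ r).re) hnhds ?_
    (hg.integrableOn_ray h1 h2 hc) (aestronglyMeasurable_deriv_ray c) ?_
    ((integrableOn_exp_ray (c + 1) h1 h2).const_mul K) ?_).2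
  · filter_upwards [lt_mem_nhds hc] with x hx using hg.aestronglyMeasurable_ray h1 h2 hx
  · filter_upwards [ae_restrict_mem measurableSet_Ioi] with r hr x hx
    rw [norm_mul, norm_exp_ofReal_mul_I, mul_one]
    refine (hK x hx.1.le r (le_of_lt hr)).2.trans ?_
    simp only [ray_re]
    gcongr
    exact hx.2.le
  · filter_upwards [ae_restrict_mem measurableSet_Ioi] with r hr x hx
    have hx0 : 0 < x := (half_pos hc).trans hx.1
    have h := (hg.diff _ (ray_mem_sector (ne_zero_of_abs h1) h2 hx0.le (le_of_lt hr)
      (Or.inl hx0))).hasDerivAt.comp x (hasDerivAt_ray_start x φ r)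
    simpa using h.mul_const (cexp (φ * I))

end SectorDecay

/-- The contour integral of `g` over the two rays from `c` in the directions `exp (± θ i)`,
run upwards. -/
noncomputable def hankelIntegral (θ : ℝ) (g : ℂ → ℂ) (c : ℝ) : ℂ :=
  (∫ r in Ioi 0, g (ray c θ r) * cexp (θ * I)) -
    ∫ r in Ioi 0, g (ray c (-θ) r) * cexp ((-θ : ℝ) * I)

namespace SectorDecay
variable {θ : ℝ} {g : ℂ → ℂ}

/-- This plays the role of Cauchy's theorem: the two ray integrals have the same derivative in `c`,
so their difference is constant. -/
theorem hankelIntegral_eq (hg : SectorDecay θ g) (h1 : Real.pi / 2 < θ) (h2 : θ < Real.pi)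
    {c c' : ℝ} (hc : 0 < c) (hc' : 0 < c') : hankelIntegral θ g c = hankelIntegral θ g c' := by
  have hθ : |θ| = θ := abs_of_pos ((half_pos Real.pi_pos).trans h1)
  have hθ' : |-θ| = θ := by rw [abs_neg, hθ]
  have hd : ∀ x ∈ Ioi (0 : ℝ), HasDerivAt (hankelIntegral θ g) 0 x := by
    intro x hx
    have h := (hasDerivAt_integral_ray (φ := θ) (by rwa [hθ]) (by rwa [hθ]) (by rwa [hθ]) hx).sub
      (hasDerivAt_integral_ray (φ := -θ) (by rwa [hθ']) (by rwa [hθ']) (by rwa [hθ']) hx)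
    rwa [sub_self] at h
  refine (convex_Ioi (0 : ℝ)).is_const_of_fderivWithin_eq_zero (𝕜 := ℝ)
    (fun x hx => (hd x hx).differentiableAt.differentiableWithinAt) (fun x hx => ?_) hc hc'
  have h : fderivWithin ℝ (hankelIntegral θ g) (Ioi 0) x = _ :=
    (hd x hx).hasFDerivAt.hasFDerivWithinAt.fderivWithin (isOpen_Ioi.uniqueDiffWithinAt hx)
  rw [h]
  ext
  simp

end SectorDecay

/-! ### The Prabhakar kernel on the sector -/

/-- The hypothesis keeps `u` out of a cone around the positive axis. It gives `|1 - u|² - (1 - k)/2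
* (1 + |u|)² ≥ (1 + k)/2 * (1 - |u|)²`. -/
theorem norm_one_sub_ge {u : ℂ} {k : ℝ} (hk : 0 ≤ k) (hk1 : k < 1) (hu : u.re ≤ k * ‖u‖) :
    √((1 - k) / 2) * (1 + ‖u‖) ≤ ‖1 - u‖ := by
  refine abs_le_of_sq_le_sq' ?_ (norm_nonneg _) |>.2
  have h1 : ‖1 - u‖ ^ 2 = 1 - 2 * u.re + ‖u‖ ^ 2 := by
    rw [Complex.sq_norm, Complex.sq_norm, normSq_apply, normSq_apply]
    simp only [sub_re, sub_im, one_re, one_im]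
    ring
  rw [mul_pow, Real.sq_sqrt (by linarith), h1]
  nlinarith [mul_nonneg (by linarith : 0 ≤ 1 + k) (sq_nonneg (1 - ‖u‖))]

theorem one_sub_mem_slitPlane {u : ℂ} {k : ℝ} (hk1 : k < 1) (hu : u.re ≤ k * ‖u‖) :
    1 - u ∈ slitPlane := by
  rw [mem_slitPlane_iff]
  by_contra! h
  simp only [sub_re, one_re, sub_im, one_im, zero_sub, neg_eq_zero] at h
  have h1 : ‖u‖ = u.re := by
    have h2 : u = (u.re : ℂ) := by apply Complex.ext <;> simp [h.2]
    rw [h2, norm_real, Real.norm_of_nonneg (by linarith), ofReal_re]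
  rw [h1] at hu
  nlinarith

/-- The integrand of the contour representation of the Prabhakar function. -/
noncomputable def prabhakarKernel (α β δ : ℝ) (z s : ℂ) : ℂ :=
  cexp s * s ^ ((-β : ℝ) : ℂ) * (1 - z * s ^ ((-α : ℝ) : ℂ)) ^ ((-δ : ℝ) : ℂ)

theorem rpow_neg_le_of_le {x y b : ℝ} (hx : 0 < x) (hxy : x ≤ y) (hb : 0 ≤ b) :
    y ^ (-b) ≤ x ^ (-b) :=
  Real.rpow_le_rpow_of_nonpos hx hxy (neg_nonpos.2 hb)

theorem hasDerivAt_prabhakarKernel {α β δ : ℝ} {z s : ℂ} (hs : s ∈ slitPlane)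
    (h : 1 - z * s ^ ((-α : ℝ) : ℂ) ∈ slitPlane) :
    HasDerivAt (prabhakarKernel α β δ z)
      (cexp s * s ^ ((-β : ℝ) : ℂ) * (1 - z * s ^ ((-α : ℝ) : ℂ)) ^ ((-δ : ℝ) : ℂ) +
        cexp s * (((-β : ℝ) : ℂ) * s ^ ((-(β + 1) : ℝ) : ℂ)) *
          (1 - z * s ^ ((-α : ℝ) : ℂ)) ^ ((-δ : ℝ) : ℂ) +
        cexp s * s ^ ((-β : ℝ) : ℂ) * (((-δ : ℝ) : ℂ) *
          (1 - z * s ^ ((-α : ℝ) : ℂ)) ^ ((-(δ + 1) : ℝ) : ℂ) *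
            (-(z * (((-α : ℝ) : ℂ) * s ^ ((-(α + 1) : ℝ) : ℂ)))))) s := by
  have hpow : ∀ b : ℝ, HasDerivAt (fun x : ℂ => x ^ ((-b : ℝ) : ℂ))
      (((-b : ℝ) : ℂ) * s ^ ((-(b + 1) : ℝ) : ℂ)) s := by
    intro b
    have h1 := (hasDerivAt_id s).cpow_const (c := ((-b : ℝ) : ℂ)) hs
    rwa [mul_one, show (((-b : ℝ) : ℂ) - 1) = ((-(b + 1) : ℝ) : ℂ) by push_cast; ring] at h1
  have h2 := ((((hpow α).const_mul z).const_sub 1).cpow_const (c := ((-δ : ℝ) : ℂ)) h)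
  have h3 := ((Complex.hasDerivAt_exp s).mul (hpow β)).mul h2
  refine h3.congr_deriv ?_
  rw [show (((-δ : ℝ) : ℂ) - 1) = ((-(δ + 1) : ℝ) : ℂ) by push_cast; ring]
  simp only [Pi.mul_apply]
  ring

theorem sectorDecay_prabhakarKernel {α β δ k θ : ℝ} {z : ℂ} (hα : 0 ≤ α) (hβ : 0 ≤ β)
    (hδ : 0 ≤ δ) (hθ : θ < Real.pi) (hk : 0 ≤ k) (hk1 : k < 1)
    (hz : ∀ s ∈ sector θ, (z * s ^ ((-α : ℝ) : ℂ)).re ≤ k * ‖z * s ^ ((-α : ℝ) : ℂ)‖) :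
    SectorDecay θ (prabhakarKernel α β δ z) := by
  have hd : ∀ s ∈ sector θ, _ := fun s hs =>
    hasDerivAt_prabhakarKernel (α := α) (β := β) (δ := δ) (z := z)
      (sector_subset_slitPlane hθ hs) (one_sub_mem_slitPlane hk1 (hz s hs))
  refine ⟨fun s hs => (hd s hs).differentiableAt, fun ρ hρ => ?_⟩
  set c₀ := √((1 - k) / 2)
  have hc₀ : 0 < c₀ := Real.sqrt_pos.2 (by linarith)
  -- The three summands bound the three terms of the derivative; the first alone bounds the kernel.
  refine ⟨ρ ^ (-β) * c₀ ^ (-δ) + β * ρ ^ (-(β + 1)) * c₀ ^ (-δ) +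
    ρ ^ (-β) * (δ * c₀ ^ (-(δ + 1)) * (‖z‖ * (α * ρ ^ (-(α + 1))))), fun s hs hsρ => ?_⟩
  have hu : c₀ ≤ ‖1 - z * s ^ ((-α : ℝ) : ℂ)‖ := by
    refine le_trans ?_ (norm_one_sub_ge hk hk1 (hz s hs))
    exact le_mul_of_one_le_right hc₀.le (by linarith [norm_nonneg (z * s ^ ((-α : ℝ) : ℂ))])
  have hspow : ∀ b : ℝ, 0 ≤ b → ‖s‖ ^ (-b) ≤ ρ ^ (-b) := fun b hb => rpow_neg_le_of_le hρ hsρ hb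
  have hupow : ∀ b : ℝ, 0 ≤ b → ‖1 - z * s ^ ((-α : ℝ) : ℂ)‖ ^ (-b) ≤ c₀ ^ (-b) :=
    fun b hb => rpow_neg_le_of_le hc₀ hu hb
  have h1 : ‖cexp s * s ^ ((-β : ℝ) : ℂ) * (1 - z * s ^ ((-α : ℝ) : ℂ)) ^ ((-δ : ℝ) : ℂ)‖ ≤
      ρ ^ (-β) * c₀ ^ (-δ) * Real.exp s.re := by
    rw [norm_mul, norm_mul, norm_exp, norm_cpow_real, norm_cpow_real, mul_assoc, mul_comm]
    have := hspow β hβ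
    have := hupow δ hδ
    gcongr
  have h2 : ‖cexp s * (((-β : ℝ) : ℂ) * s ^ ((-(β + 1) : ℝ) : ℂ)) *
      (1 - z * s ^ ((-α : ℝ) : ℂ)) ^ ((-δ : ℝ) : ℂ)‖ ≤
      β * ρ ^ (-(β + 1)) * c₀ ^ (-δ) * Real.exp s.re := by
    rw [norm_mul, norm_mul, norm_mul, norm_exp, norm_cpow_real, norm_cpow_real, mul_assoc,
      mul_comm, norm_real, norm_neg, Real.norm_of_nonneg hβ]
    have := hspow (β + 1) (by linarith)
    have := hupow δ hδ
    gcongr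
  have h3 : ‖cexp s * s ^ ((-β : ℝ) : ℂ) * (((-δ : ℝ) : ℂ) *
      (1 - z * s ^ ((-α : ℝ) : ℂ)) ^ ((-(δ + 1) : ℝ) : ℂ) *
      (-(z * (((-α : ℝ) : ℂ) * s ^ ((-(α + 1) : ℝ) : ℂ)))))‖ ≤
      ρ ^ (-β) * (δ * c₀ ^ (-(δ + 1)) * (‖z‖ * (α * ρ ^ (-(α + 1))))) * Real.exp s.re := by
    rw [norm_mul, norm_mul, norm_mul, norm_mul, norm_neg, norm_mul, norm_mul, norm_exp,
      norm_cpow_real, norm_cpow_real, norm_cpow_real, mul_assoc,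
      mul_comm, norm_real, norm_neg, Real.norm_of_nonneg hδ, norm_real, norm_neg,
      Real.norm_of_nonneg hα]
    have := hspow β hβ
    have := hspow (α + 1) (by linarith)
    have := hupow (δ + 1) (by linarith)
    gcongr
  rw [(hd s hs).deriv]
  constructor
  · refine h1.trans ?_
    gcongr
    have h4 : 0 ≤ β * ρ ^ (-(β + 1)) * c₀ ^ (-δ) := by positivity
    have h5 : 0 ≤ ρ ^ (-β) * (δ * c₀ ^ (-(δ + 1)) * (‖z‖ * (α * ρ ^ (-(α + 1))))) := by positivity
    linarith
  · rw [add_mul, add_mul]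
    exact (norm_add₃_le).trans (add_le_add (add_le_add h1 h2) h3)

/-! ### Hankel's formula for the reciprocal Gamma function -/

/-- The integrand `exp s * s ^ (-w)` of Hankel's integral for `1 / Γ(w)`. -/
noncomputable def hankelKernel (w : ℝ) (s : ℂ) : ℂ := cexp s * s ^ ((-w : ℝ) : ℂ)

theorem prabhakarKernel_zero (w : ℝ) : prabhakarKernel 0 w 0 0 = hankelKernel w := by
  ext s
  simp [prabhakarKernel, hankelKernel]

theorem sectorDecay_hankelKernel {θ w : ℝ} (hθ : θ < Real.pi) (hw : 0 ≤ w) :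
    SectorDecay θ (hankelKernel w) := by
  rw [← prabhakarKernel_zero]
  exact sectorDecay_prabhakarKernel le_rfl hw le_rfl hθ le_rfl one_pos (by simp)

theorem norm_hankelKernel (w : ℝ) (s : ℂ) :
    ‖hankelKernel w s‖ = Real.exp s.re * ‖s‖ ^ (-w) := by
  rw [hankelKernel, norm_mul, norm_exp, norm_cpow_real]

theorem deriv_hankelKernel (w : ℝ) {s : ℂ} (hs : s ∈ slitPlane) :
    deriv (hankelKernel w) s = hankelKernel w s - w * hankelKernel (w + 1) s := by
  have h := (hasDerivAt_prabhakarKernel (α := 0) (β := w) (δ := 0) (z := 0) hs (by simp)).deriv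
  rw [prabhakarKernel_zero] at h
  rw [h, hankelKernel, hankelKernel]
  simp
  ring

/-- Integration by parts along the ray. The boundary term is the same for both rays, so it cancels
in `hankelIntegral` and leaves the recurrence of `1/Γ`. -/
theorem integral_hankelKernel_ray_add_one {φ w c : ℝ} (h1 : Real.pi / 2 < |φ|)
    (h2 : |φ| < Real.pi) (hw : 0 ≤ w) (hc : 0 < c) :
    (∫ r in Ioi 0, hankelKernel w (ray c φ r) * cexp (φ * I)) -
      w * ∫ r in Ioi 0, hankelKernel (w + 1) (ray c φ r) * cexp (φ * I) = -hankelKernel w c := by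
  have hg := sectorDecay_hankelKernel h2 hw
  have hg1 := sectorDecay_hankelKernel (w := w + 1) h2 (by linarith)
  rw [← hg.integral_deriv_ray h1 h2 hc, ← integral_const_mul, ← integral_sub
    (hg.integrableOn_ray h1 h2 hc) ((hg1.integrableOn_ray h1 h2 hc).const_mul _)]
  refine setIntegral_congr_fun measurableSet_Ioi fun r hr => ?_
  have hs := ray_mem_sector (ne_zero_of_abs h1) h2 hc.le (le_of_lt hr) (Or.inl hc)
  simp only [deriv_hankelKernel w (sector_subset_slitPlane h2 hs)]
  ring

/-- Used with `φ = ±θ`, `σ = ±π`. Since `cos φ < 0`, the point `-exp (φ i) = exp ((φ - σ) i)` lies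
in the right half plane and the integral is a Laplace transform. The phases `φ (1 - w)` and `-(1 -
w)(φ - σ)` add up to `σ (1 - w)`. -/
theorem integral_hankelKernel_ray_zero {φ σ w : ℝ} (h1 : Real.pi / 2 < |φ|) (h2 : |φ| < Real.pi)
    (hσ : cexp (σ * I) = -1) (hφσ : |φ - σ| < Real.pi) (hw1 : w < 1) :
    ∫ r in Ioi 0, hankelKernel w (ray 0 φ r) * cexp (φ * I) =
      cexp ((σ * (1 - w) : ℝ) * I) * Gamma ((1 - w : ℝ) : ℂ) := by
  have hp : cexp ((φ - σ : ℝ) * I) = -cexp (φ * I) := by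
    have : cexp ((φ - σ : ℝ) * I) * cexp (σ * I) = cexp (φ * I) := by
      rw [← Complex.exp_add]; congr 1; push_cast; ring
    rw [hσ] at this
    rw [← this]; ring
  have hre : 0 < (-cexp (φ * I)).re := by
    rw [neg_re, exp_ofReal_mul_I_re]
    linarith [cos_neg_of_abs h1 h2]
  have hL := laplace_rpow (a := 1 - w) (by linarith) hre
  have hpow : (-cexp (φ * I)) ^ (-((1 - w : ℝ) : ℂ)) = cexp ((-(1 - w) * (φ - σ) : ℝ) * I) := by
    rw [cpow_def_of_ne_zero (neg_ne_zero.2 (Complex.exp_ne_zero _)), ← hp, log_exp]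
    · congr 1; push_cast; ring
    · simpa using (abs_lt.1 hφσ).1
    · simpa using (abs_lt.1 hφσ).2.le
  have hcong : ∫ r in Ioi 0, hankelKernel w (ray 0 φ r) * cexp (φ * I) =
      ∫ r : ℝ in Ioi 0, cexp ((φ * (1 - w) : ℝ) * I) *
        (((r ^ (1 - w - 1) : ℝ) : ℂ) * cexp (-(-cexp (φ * I) * r))) := by
    refine setIntegral_congr_fun measurableSet_Ioi fun r hr => ?_
    have hr0 : (0 : ℝ) < r := hr
    have hlog : Complex.log (ray 0 φ r) = (Real.log r : ℂ) + φ * I := by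
      rw [ray, ofReal_zero, zero_add, log_ofReal_mul hr0 (Complex.exp_ne_zero _), log_exp]
      · simpa using (abs_lt.1 h2).1
      · simpa using (abs_lt.1 h2).2.le
    have hne : ray 0 φ r ≠ 0 := ray_ne_zero (ne_zero_of_abs h1) h2 le_rfl hr0.le (Or.inr hr0)
    have hray : cexp (-(-cexp (φ * I) * r)) = cexp (ray 0 φ r) := by
      congr 1; rw [ray]; push_cast; ring
    rw [hray, hankelKernel, cpow_def_of_ne_zero hne, hlog, Real.rpow_def_of_pos hr0, ofReal_exp]
    simp only [← Complex.exp_add]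
    congr 1
    push_cast
    ring
  rw [hcong, integral_const_mul, hL, hpow, ← mul_assoc, ← Complex.exp_add]
  congr 2
  push_cast
  ring

/-- The bound `|s| ≥ r |sin φ|` gives a majorant `r ^ (-w)` times a decaying exponential,
independent of `c`; it is integrable at `0` because `w < 1`. -/
theorem tendsto_integral_hankelKernel_ray {φ w : ℝ} (h1 : Real.pi / 2 < |φ|) (h2 : |φ| < Real.pi)
    (hw : 0 ≤ w) (hw1 : w < 1) :
    Tendsto (fun c : ℝ => ∫ r in Ioi 0, hankelKernel w (ray c φ r) * cexp (φ * I)) (𝓝[>] 0)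
      (𝓝 (∫ r in Ioi 0, hankelKernel w (ray 0 φ r) * cexp (φ * I))) := by
  have hg := sectorDecay_hankelKernel h2 hw
  have hφ0 := ne_zero_of_abs h1
  have hs := abs_sin_pos hφ0 h2
  have hint := (integrableOn_rpow_mul_exp_neg_mul (a := -w) (by linarith)
    (neg_pos.2 (cos_neg_of_abs h1 h2))).const_mul (Real.exp 1 * |Real.sin φ| ^ (-w))
  refine tendsto_integral_filter_of_dominated_convergence _ ?_ ?_ hint ?_
  · filter_upwards [self_mem_nhdsWithin] with c hc using hg.aestronglyMeasurable_ray h1 h2 hc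
  · filter_upwards [self_mem_nhdsWithin, nhdsWithin_le_nhds (gt_mem_nhds one_pos)] with c hc hc1
    filter_upwards [ae_restrict_mem measurableSet_Ioi] with r hr
    have hr0 : (0 : ℝ) < r := hr
    rw [norm_mul, norm_exp_ofReal_mul_I, mul_one, norm_hankelKernel, ray_re]
    have h3 := rpow_neg_le_of_le (mul_pos hr0 hs) (mul_abs_sin_le_norm_ray (c := c) hr0.le) hw
    rw [Real.mul_rpow hr0.le hs.le] at h3
    calc _ ≤ Real.exp (1 + r * Real.cos φ) * (r ^ (-w) * |Real.sin φ| ^ (-w)) := by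
          gcongr
      _ = _ := by
          rw [Real.exp_add, neg_neg, mul_comm r]; ring
  · filter_upwards [ae_restrict_mem measurableSet_Ioi] with r hr
    have hmem := ray_mem_sector hφ0 h2 le_rfl (le_of_lt hr) (Or.inr hr)
    have hcont : ContinuousAt (fun c => hankelKernel w (ray c φ r) * cexp (φ * I)) 0 :=
      ((hg.diff _ hmem).continuousAt.comp
        (f := fun c => ray c φ r) (hasDerivAt_ray_start 0 φ r).continuousAt).mul_const _
    exact hcont.tendsto.mono_left nhdsWithin_le_nhds

/-- Letting `c → 0` gives `2i sin(π(1 - w)) Γ(1 - w)`, which is `2πi / Γ(w)` by the reflection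
formula. -/
theorem hankelIntegral_hankelKernel_of_lt_one {θ w c : ℝ} (h1 : Real.pi / 2 < θ)
    (h2 : θ < Real.pi) (hw : 0 < w) (hw1 : w < 1) (hc : 0 < c) :
    hankelIntegral θ (hankelKernel w) c = 2 * Real.pi * I * (Gamma w)⁻¹ := by
  have hθ0 : 0 < θ := (half_pos Real.pi_pos).trans h1
  have hθ : |θ| = θ := abs_of_pos hθ0
  have hθ' : |-θ| = θ := by rw [abs_neg, hθ]
  have hlim : Tendsto (hankelIntegral θ (hankelKernel w)) (𝓝[>] 0)
      (𝓝 (cexp ((Real.pi * (1 - w) : ℝ) * I) * Gamma ((1 - w : ℝ) : ℂ) -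
        cexp ((-Real.pi * (1 - w) : ℝ) * I) * Gamma ((1 - w : ℝ) : ℂ))) := by
    rw [← integral_hankelKernel_ray_zero (φ := θ) (σ := Real.pi) (by rwa [hθ]) (by rwa [hθ])
        exp_pi_mul_I (by rw [abs_lt]; constructor <;> linarith) hw1,
      ← integral_hankelKernel_ray_zero (φ := -θ) (σ := -Real.pi) (by rwa [hθ']) (by rwa [hθ'])
        (by rw [ofReal_neg, neg_mul, Complex.exp_neg, exp_pi_mul_I]; norm_num)
        (by rw [abs_lt]; constructor <;> linarith) hw1]
    exact (tendsto_integral_hankelKernel_ray (by rwa [hθ]) (by rwa [hθ]) hw.le hw1).sub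
      (tendsto_integral_hankelKernel_ray (by rwa [hθ']) (by rwa [hθ']) hw.le hw1)
  have hconst : Tendsto (hankelIntegral θ (hankelKernel w)) (𝓝[>] 0)
      (𝓝 (hankelIntegral θ (hankelKernel w) c)) := by
    refine tendsto_const_nhds.congr' ?_
    filter_upwards [self_mem_nhdsWithin] with x hx
    exact (sectorDecay_hankelKernel h2 hw.le).hankelIntegral_eq h1 h2 hc hx
  rw [tendsto_nhds_unique hconst hlim]
  have hsin : Complex.sin (Real.pi * (1 - w : ℝ)) ≠ 0 := by
    rw [← ofReal_mul, ← ofReal_sin]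
    exact_mod_cast (Real.sin_pos_of_pos_of_lt_pi (by nlinarith [Real.pi_pos])
      (by nlinarith [Real.pi_pos])).ne'
  have hG : Gamma (w : ℂ) ≠ 0 := by
    rw [Gamma_ofReal]
    exact_mod_cast (Real.Gamma_pos_of_pos hw).ne'
  have hrefl := Complex.Gamma_mul_Gamma_one_sub ((1 - w : ℝ) : ℂ)
  rw [show (1 : ℂ) - ((1 - w : ℝ) : ℂ) = w by push_cast; ring, eq_div_iff hsin,
    Complex.sin] at hrefl
  rw [eq_mul_inv_iff_mul_eq₀ hG, ← hrefl]
  rw [show (-Real.pi * (1 - w) : ℝ) * I = -(Real.pi * ((1 - w : ℝ) : ℂ)) * I by push_cast; ring,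
    show (Real.pi * (1 - w) : ℝ) * I = (Real.pi * ((1 - w : ℝ) : ℂ)) * I by push_cast; ring]
  ring_nf
  rw [I_sq]
  ring

theorem continuousAt_integral_hankelKernel_ray {φ : ℝ} (h1 : Real.pi / 2 < |φ|)
    (h2 : |φ| < Real.pi) :
    ContinuousAt (fun w : ℝ => ∫ r in Ioi 0, hankelKernel w (ray 1 φ r) * cexp (φ * I)) 1 := by
  have hφ0 := ne_zero_of_abs h1
  have hs := abs_sin_pos hφ0 h2
  have hnear : ∀ᶠ w : ℝ in 𝓝 1, 0 ≤ w ∧ w ≤ 2 := by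
    filter_upwards [Icc_mem_nhds (by norm_num : (0 : ℝ) < 1) (by norm_num : (1 : ℝ) < 2)] with w hw
      using hw
  refine continuousAt_of_dominated
    (bound := fun r => |Real.sin φ| ^ (-2 : ℝ) * Real.exp (ray 1 φ r).re) ?_ ?_
    ((integrableOn_exp_ray 1 h1 h2).const_mul _) ?_
  · filter_upwards [hnear] with w hw
    exact (sectorDecay_hankelKernel h2 hw.1).aestronglyMeasurable_ray h1 h2 one_pos
  · filter_upwards [hnear] with w hw
    filter_upwards [ae_restrict_mem measurableSet_Ioi] with r hr
    rw [norm_mul, norm_exp_ofReal_mul_I, mul_one, norm_hankelKernel, mul_comm]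
    have h3 := start_mul_abs_sin_le_norm_ray (c := 1) (φ := φ) (r := r) one_pos.le
    rw [one_mul] at h3
    gcongr
    exact (rpow_neg_le_of_le hs h3 hw.1).trans
      (Real.rpow_le_rpow_of_exponent_ge hs (Real.abs_sin_le_one φ) (by linarith [hw.2]))
  · filter_upwards [ae_restrict_mem measurableSet_Ioi] with r hr
    have hne : ray 1 φ r ≠ 0 := ray_ne_zero hφ0 h2 one_pos.le (le_of_lt hr) (Or.inl one_pos)
    have hcont : Continuous fun w : ℝ => ray 1 φ r ^ ((-w : ℝ) : ℂ) := by
      simp only [cpow_def_of_ne_zero hne]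
      fun_prop
    exact ((continuous_const.mul hcont).mul continuous_const).continuousAt

/-- The limit `c → 0` needs `w < 1`, and the recurrence at `w = 0` carries the factor `0`, so `w =
1` is reached by continuity in `w`. -/
theorem hankelIntegral_hankelKernel_one {θ c : ℝ} (h1 : Real.pi / 2 < θ)
    (h2 : θ < Real.pi) (hc : 0 < c) :
    hankelIntegral θ (hankelKernel 1) c = 2 * Real.pi * I * (Gamma (1 : ℝ))⁻¹ := by
  have hθ : |θ| = θ := abs_of_pos ((half_pos Real.pi_pos).trans h1)
  have hθ' : |-θ| = θ := by rw [abs_neg, hθ]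
  rw [(sectorDecay_hankelKernel h2 one_pos.le).hankelIntegral_eq h1 h2 hc one_pos]
  have hL : ContinuousAt (fun w : ℝ => hankelIntegral θ (hankelKernel w) 1) 1 :=
    (continuousAt_integral_hankelKernel_ray (by rwa [hθ]) (by rwa [hθ])).sub
      (continuousAt_integral_hankelKernel_ray (by rwa [hθ']) (by rwa [hθ']))
  have hR : ContinuousAt (fun w : ℝ => 2 * Real.pi * I * (Gamma (w : ℂ))⁻¹) 1 :=
    continuousAt_const.mul
      (differentiable_one_div_Gamma.continuous.comp continuous_ofReal).continuousAt
  have hev : (fun w : ℝ => hankelIntegral θ (hankelKernel w) 1) =ᶠ[𝓝[<] 1]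
      fun w : ℝ => 2 * Real.pi * I * (Gamma (w : ℂ))⁻¹ := by
    filter_upwards [self_mem_nhdsWithin, nhdsWithin_le_nhds (lt_mem_nhds one_pos)] with w hw1 hw
    exact hankelIntegral_hankelKernel_of_lt_one h1 h2 hw hw1 one_pos
  exact tendsto_nhds_unique ((hL.tendsto.mono_left nhdsWithin_le_nhds).congr' hev)
    (hR.tendsto.mono_left nhdsWithin_le_nhds)

theorem hankelIntegral_hankelKernel_add_one {θ w c : ℝ} (h1 : Real.pi / 2 < θ)
    (h2 : θ < Real.pi) (hw : 0 ≤ w) (hc : 0 < c) :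
    hankelIntegral θ (hankelKernel w) c = w * hankelIntegral θ (hankelKernel (w + 1)) c := by
  have hθ : |θ| = θ := abs_of_pos ((half_pos Real.pi_pos).trans h1)
  have hθ' : |-θ| = θ := by rw [abs_neg, hθ]
  have hp := integral_hankelKernel_ray_add_one (φ := θ) (by rwa [hθ]) (by rwa [hθ]) hw hc
  have hn := integral_hankelKernel_ray_add_one (φ := -θ) (by rwa [hθ']) (by rwa [hθ']) hw hc
  rw [hankelIntegral, hankelIntegral]
  linear_combination hp - hn

/-- **Hankel's formula** for `1 / Γ(w)`, for real `w > 0`. -/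
theorem hankelIntegral_hankelKernel {θ w c : ℝ} (h1 : Real.pi / 2 < θ) (h2 : θ < Real.pi)
    (hw : 0 < w) (hc : 0 < c) :
    hankelIntegral θ (hankelKernel w) c = 2 * Real.pi * I * (Gamma w)⁻¹ := by
  have key : ∀ n : ℕ, ∀ w : ℝ, 0 < w → w ≤ n + 1 →
      hankelIntegral θ (hankelKernel w) c = 2 * Real.pi * I * (Gamma w)⁻¹ := by
    intro n
    induction n with
    | zero =>
      intro w hw hw1
      rw [Nat.cast_zero, zero_add] at hw1
      rcases hw1.lt_or_eq with h | rfl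
      · exact hankelIntegral_hankelKernel_of_lt_one h1 h2 hw h hc
      · exact hankelIntegral_hankelKernel_one h1 h2 hc
    | succ n ih =>
      intro w hw hwn
      by_cases hle : w ≤ 1
      · exact ih w hw (hle.trans (by linarith [n.cast_nonneg (α := ℝ)]))
      · push_cast at hwn
        have hpos : 0 < w - 1 := by linarith
        have hne : ((w - 1 : ℝ) : ℂ) ≠ 0 := ofReal_ne_zero.2 hpos.ne'
        have h := ih (w - 1) hpos (by linarith)
        rw [hankelIntegral_hankelKernel_add_one h1 h2 hpos.le hc, sub_add_cancel] at h
        have hG := Complex.Gamma_add_one _ hne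
        rw [show ((w - 1 : ℝ) : ℂ) + 1 = w by push_cast; ring] at hG
        rw [hG, mul_inv, mul_left_comm, ← h, inv_mul_cancel_left₀ hne]
  obtain ⟨n, hn⟩ := exists_nat_ge w
  exact key n w hw (by linarith)

/-! ### Binomial expansion and the contour representation -/

theorem hasSum_ascPochhammer_mul_pow (δ : ℂ) {u : ℂ} (hu : ‖u‖ < 1) :
    HasSum (fun n : ℕ => (ascPochhammer ℂ n).eval δ / (n.factorial : ℂ) * u ^ n)
      ((1 - u) ^ (-δ)) := by
  have h := (one_div_one_sub_cpow_hasFPowerSeriesOnBall_zero δ).hasSum (y := u)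
    (by rw [← ENNReal.ofReal_one, Metric.eball_ofReal]; simpa using hu)
  simp only [zero_add, one_div, ← cpow_neg] at h
  convert! h using 2 with n
  have h1 := Ring.factorial_nsmul_multichoose_eq_ascPochhammer δ n
  rw [Polynomial.ascPochhammer_smeval_eq_eval, nsmul_eq_mul] at h1
  rw [← h1, mul_div_cancel_left₀ _ (by exact_mod_cast n.factorial_ne_zero),
    FormalMultilinearSeries.ofScalars_apply_eq, Ring.multichoose_eq, smul_eq_mul]

theorem mul_cpow_pow_mul_cpow {s : ℂ} (hs : s ≠ 0) (α β : ℝ) (z : ℂ) (n : ℕ) :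
    (z * s ^ ((-α : ℝ) : ℂ)) ^ n * s ^ ((-β : ℝ) : ℂ) =
      z ^ n * s ^ ((-(α * n + β) : ℝ) : ℂ) := by
  rw [mul_pow, ← cpow_nat_mul, mul_assoc, ← cpow_add _ _ hs]
  congr 2
  push_cast
  ring

theorem hasSum_prabhakarKernel {α β δ : ℝ} {z s : ℂ} (hs : s ≠ 0)
    (hu : ‖z * s ^ ((-α : ℝ) : ℂ)‖ < 1) :
    HasSum (fun n : ℕ => (ascPochhammer ℂ n).eval (δ : ℂ) / (n.factorial : ℂ) * z ^ n *
      hankelKernel (α * n + β) s) (prabhakarKernel α β δ z s) := by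
  have h := (hasSum_ascPochhammer_mul_pow δ hu).mul_left (cexp s * s ^ ((-β : ℝ) : ℂ))
  rw [← ofReal_neg] at h
  rw [prabhakarKernel]
  convert! h using 2 with n
  rw [hankelKernel, mul_left_comm _ (cexp s), mul_assoc _ (z ^ n), ← mul_cpow_pow_mul_cpow hs]
  ring

/-- The condition on `c` forces `|u| ≤ 1/2` on the whole ray. The terms are then dominated by the
absolutely convergent binomial series at `1/2` times an integrable function, so sum and integral
commute. -/
theorem hasSum_integral_prabhakarKernel {α β δ φ c : ℝ} {z : ℂ} (hα : 0 ≤ α) (hβ : 0 ≤ β)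
    (h1 : Real.pi / 2 < |φ|) (h2 : |φ| < Real.pi) (hc : 0 < c)
    (hzc : ‖z‖ * (c * |Real.sin φ|) ^ (-α) ≤ 1 / 2) :
    HasSum (fun n : ℕ => (ascPochhammer ℂ n).eval (δ : ℂ) / (n.factorial : ℂ) * z ^ n *
      ∫ r in Ioi 0, hankelKernel (α * n + β) (ray c φ r) * cexp (φ * I))
      (∫ r in Ioi 0, prabhakarKernel α β δ z (ray c φ r) * cexp (φ * I)) := by
  have hφ0 := ne_zero_of_abs h1
  have hs := abs_sin_pos hφ0 h2
  set a : ℕ → ℂ := fun n => (ascPochhammer ℂ n).eval (δ : ℂ) / (n.factorial : ℂ)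
  set F : ℕ → ℝ → ℂ := fun n r =>
    a n * z ^ n * (hankelKernel (α * n + β) (ray c φ r) * cexp (φ * I)) with hF
  have hne : ∀ r > 0, ray c φ r ≠ 0 := fun r hr => ray_ne_zero hφ0 h2 hc.le hr.le (Or.inl hc)
  have hnorm : ∀ r > 0, ∀ b : ℝ, 0 ≤ b → ‖ray c φ r‖ ^ (-b) ≤ (c * |Real.sin φ|) ^ (-b) :=
    fun r _ b hb => rpow_neg_le_of_le (mul_pos hc hs) (start_mul_abs_sin_le_norm_ray hc.le) hb
  have hu : ∀ r > 0, ‖z * ray c φ r ^ ((-α : ℝ) : ℂ)‖ ≤ 1 / 2 := by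
    intro r hr
    rw [norm_mul, norm_cpow_real]
    exact (mul_le_mul_of_nonneg_left (hnorm r hr α hα) (norm_nonneg z)).trans hzc
  have hFint : ∀ n, IntegrableOn (F n) (Ioi 0) := fun n =>
    ((sectorDecay_hankelKernel h2 (by positivity)).integrableOn_ray h1 h2 hc).const_mul _
  have hFle : ∀ n, ∀ r > 0, ‖F n r‖ ≤
      ‖a n * (1 / 2) ^ n‖ * ((c * |Real.sin φ|) ^ (-β) * Real.exp (ray c φ r).re) := by
    intro n r hr
    have h3 : F n r = a n * (cexp (ray c φ r) * cexp (φ * I) *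
        ((z * ray c φ r ^ ((-α : ℝ) : ℂ)) ^ n * ray c φ r ^ ((-β : ℝ) : ℂ))) := by
      rw [mul_cpow_pow_mul_cpow (hne r hr)]
      simp only [hF, hankelKernel]
      ring
    have hhalf : ‖a n * (1 / 2) ^ n‖ = ‖a n‖ * (1 / 2) ^ n := by
      rw [norm_mul, norm_pow, norm_div 1, norm_one, norm_ofNat]
    rw [h3, hhalf, norm_mul, norm_mul, norm_mul, norm_mul, norm_exp_ofReal_mul_I, norm_exp,
      norm_pow, norm_cpow_real, mul_one]
    have := hu r hr
    have := hnorm r hr β hβ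
    calc _ ≤ ‖a n‖ * (Real.exp (ray c φ r).re * ((1 / 2) ^ n * (c * |Real.sin φ|) ^ (-β))) := by
          gcongr
      _ = _ := by ring
  have hsum : Summable fun n => ∫ r in Ioi 0, ‖F n r‖ := by
    refine Summable.of_nonneg_of_le (fun n => integral_nonneg fun r => norm_nonneg _) (fun n => ?_)
      ((hasSum_ascPochhammer_mul_pow δ (u := 1 / 2) (by norm_num)).summable.norm.mul_right
        (∫ r in Ioi 0, (c * |Real.sin φ|) ^ (-β) * Real.exp (ray c φ r).re))
    rw [← integral_const_mul]
    exact setIntegral_mono_on (hFint n).norm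
      (((integrableOn_exp_ray c h1 h2).const_mul _).const_mul _) measurableSet_Ioi
      fun r hr => hFle n r hr
  have h := hasSum_integral_of_summable_integral_norm hFint hsum
  simp only [hF, integral_const_mul] at h
  convert! h using 1
  refine setIntegral_congr_fun measurableSet_Ioi fun r hr => ?_
  have h4 := (hasSum_prabhakarKernel (δ := δ) (β := β) (hne r hr)
    ((hu r hr).trans_lt (by norm_num))).mul_right (cexp (φ * I))
  rw [← h4.tsum_eq]
  exact tsum_congr fun n => mul_assoc _ _ _

/-- The contour representation of the Prabhakar function. -/
theorem hankelIntegral_prabhakarKernel {α β δ k θ c : ℝ} {z : ℂ} (hα : 0 < α) (hβ : 0 < β)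
    (hδ : 0 ≤ δ) (h1 : Real.pi / 2 < θ) (h2 : θ < Real.pi) (hc : 0 < c) (hk : 0 ≤ k) (hk1 : k < 1)
    (hz : ∀ s ∈ sector θ, (z * s ^ ((-α : ℝ) : ℂ)).re ≤ k * ‖z * s ^ ((-α : ℝ) : ℂ)‖) :
    hankelIntegral θ (prabhakarKernel α β δ z) c = 2 * Real.pi * I * prabhakar α β δ z := by
  have hθ : |θ| = θ := abs_of_pos ((half_pos Real.pi_pos).trans h1)
  have hθ' : |-θ| = θ := by rw [abs_neg, hθ]
  have hs : 0 < |Real.sin θ| :=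
    abs_sin_pos ((half_pos Real.pi_pos).trans h1).ne' (by rwa [hθ])
  -- A start `x` far enough to the right for the termwise expansion on both rays.
  obtain ⟨x, hx0, hx⟩ : ∃ x : ℝ, 0 < x ∧ ‖z‖ * (x * |Real.sin θ|) ^ (-α) ≤ 1 / 2 := by
    have ht : Tendsto (fun x : ℝ => ‖z‖ * (x * |Real.sin θ|) ^ (-α)) atTop (𝓝 (‖z‖ * 0)) :=
      ((tendsto_rpow_neg_atTop hα).comp (tendsto_id.atTop_mul_const hs)).const_mul _
    rw [mul_zero] at ht
    obtain ⟨x, hx1, hx2⟩ := ((eventually_gt_atTop 0).and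
      (ht.eventually_le_const (by norm_num : (0 : ℝ) < 1 / 2))).exists
    exact ⟨x, hx1, hx2⟩
  rw [(sectorDecay_prabhakarKernel hα.le hβ.le hδ h2 hk hk1 hz).hankelIntegral_eq h1 h2 hc hx0]
  have hp := hasSum_integral_prabhakarKernel (φ := θ) (δ := δ) hα.le hβ.le (by rwa [hθ])
    (by rwa [hθ]) hx0 hx
  have hn := hasSum_integral_prabhakarKernel (φ := -θ) (δ := δ) hα.le hβ.le (by rwa [hθ'])
    (by rwa [hθ']) hx0 (by rwa [Real.sin_neg, abs_neg])
  rw [hankelIntegral, ← (hp.sub hn).tsum_eq, prabhakar, ← tsum_mul_left]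
  refine tsum_congr fun n => ?_
  have h := hankelIntegral_hankelKernel (w := α * n + β) h1 h2 (by positivity) hx0
  rw [hankelIntegral] at h
  rw [← mul_sub, h]
  push_cast
  rw [div_mul_eq_div_div]
  ring

/-! ### Uniform estimate of the contour integral -/

theorem exists_one_add_rpow_le_exp {p b : ℝ} (hp : 0 ≤ p) (hb : 0 < b) :
    ∃ K : ℝ, 0 ≤ K ∧ ∀ r : ℝ, 0 ≤ r → (1 + r) ^ p ≤ K * Real.exp (b * r) := by
  -- Ensures `ε p ≤ b` even when `p = 0`; the inequality `ε(1 + r) ≤ exp (ε(1 + r))` is then raised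
  -- to the power `p`.
  set ε := b / (p + 1)
  have hε : 0 < ε := by positivity
  have hεp : ε * p ≤ b := by
    rw [div_mul_eq_mul_div, div_le_iff₀ (by positivity)]
    nlinarith
  refine ⟨ε ^ (-p) * Real.exp b, by positivity, fun r hr => ?_⟩
  have h1 : ε * (1 + r) ≤ Real.exp (ε * (1 + r)) := by
    linarith [Real.add_one_le_exp (ε * (1 + r))]
  have h2 : ε ^ p * (1 + r) ^ p ≤ Real.exp (b * (1 + r)) := by
    rw [← Real.mul_rpow hε.le (by positivity)]
    refine (Real.rpow_le_rpow (by positivity) h1 hp).trans ?_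
    rw [← Real.exp_mul, Real.exp_le_exp]
    nlinarith
  rw [mul_assoc, ← Real.exp_add, Real.rpow_neg hε.le, ← div_eq_inv_mul,
    le_div_iff₀ (by positivity), mul_comm, show b + b * r = b * (1 + r) by ring]
  exact h2

/-- The summand `1` uses `y ≥ c₀`, the summand `x ^ δ` uses `y ≥ c₀ x t`. -/
theorem one_add_rpow_mul_rpow_neg_le {x t c₀ δ : ℝ} (hx : 0 < x) (ht : 0 < t) (hc₀ : 0 < c₀)
    (hδ : 0 ≤ δ) {y : ℝ} (hy : c₀ * (1 + x * t) ≤ y) :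
    (1 + x ^ δ) * y ^ (-δ) ≤ c₀ ^ (-δ) * (1 + t ^ (-δ)) := by
  have hxt : 0 < x * t := mul_pos hx ht
  have h1 : y ^ (-δ) ≤ c₀ ^ (-δ) :=
    rpow_neg_le_of_le hc₀ (le_trans (by nlinarith) hy) hδ
  have h2 : y ^ (-δ) ≤ c₀ ^ (-δ) * (x ^ (-δ) * t ^ (-δ)) := by
    rw [← Real.mul_rpow hx.le ht.le, ← Real.mul_rpow hc₀.le hxt.le]
    exact rpow_neg_le_of_le (by positivity) (le_trans (by nlinarith) hy) hδ
  calc (1 + x ^ δ) * y ^ (-δ) = y ^ (-δ) + x ^ δ * y ^ (-δ) := by ring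
    _ ≤ c₀ ^ (-δ) + x ^ δ * (c₀ ^ (-δ) * (x ^ (-δ) * t ^ (-δ))) := by gcongr
    _ = c₀ ^ (-δ) * (1 + t ^ (-δ)) := by
      have : x ^ δ * x ^ (-δ) = 1 := by
        rw [← Real.rpow_add hx, add_neg_cancel, Real.rpow_zero]
      linear_combination c₀ ^ (-δ) * t ^ (-δ) * this

theorem norm_ray_le {c φ r : ℝ} (hc : 0 ≤ c) (hr : 0 ≤ r) : ‖ray c φ r‖ ≤ c + r := by
  refine (norm_add_le _ _).trans_eq ?_
  rw [norm_mul, norm_exp_ofReal_mul_I, norm_real, norm_real, Real.norm_of_nonneg hc,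
    Real.norm_of_nonneg hr, mul_one]

/-- Since `√((1 - k) / 2) ≤ 1 ≤ R`, replacing `δ` by `D` only enlarges the two powers on the right;
this makes the bound uniform in `δ`. -/
theorem norm_prabhakarKernel_le {α β δ k D : ℝ} {z s : ℂ} (hα : 0 ≤ α) (hδ : 0 ≤ δ) (hδD : δ ≤ D)
    (hk : 0 ≤ k) (hk1 : k < 1) (hz0 : z ≠ 0) (hs0 : s ≠ 0)
    (hz : (z * s ^ ((-α : ℝ) : ℂ)).re ≤ k * ‖z * s ^ ((-α : ℝ) : ℂ)‖) {R : ℝ} (hR : 1 ≤ R)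
    (hsR : ‖s‖ ≤ R) :
    (1 + ‖z‖ ^ δ) * ‖prabhakarKernel α β δ z s‖ ≤
      Real.exp s.re * ‖s‖ ^ (-β) * (√((1 - k) / 2) ^ (-D) * (1 + R ^ (α * D))) := by
  have hs : 0 < ‖s‖ := norm_pos_iff.2 hs0
  have hc₀ : 0 < √((1 - k) / 2) := Real.sqrt_pos.2 (by linarith)
  have hc₁ : √((1 - k) / 2) ≤ 1 := Real.sqrt_le_one.2 (by linarith)
  have h1 := norm_one_sub_ge hk hk1 hz
  rw [norm_mul, norm_cpow_real] at h1
  have h2 := one_add_rpow_mul_rpow_neg_le (norm_pos_iff.2 hz0)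
    (Real.rpow_pos_of_pos hs (-α)) hc₀ hδ h1
  rw [prabhakarKernel, norm_mul, norm_mul, norm_exp, norm_cpow_real, norm_cpow_real,
    mul_left_comm]
  refine mul_le_mul_of_nonneg_left (h2.trans ?_) (by positivity)
  rw [← Real.rpow_mul hs.le, neg_mul_neg]
  have h3 : √((1 - k) / 2) ^ (-δ) ≤ √((1 - k) / 2) ^ (-D) :=
    Real.rpow_le_rpow_of_exponent_ge hc₀ hc₁ (by linarith)
  have h4 : ‖s‖ ^ (α * δ) ≤ R ^ (α * D) :=
    (Real.rpow_le_rpow hs.le hsR (by positivity)).trans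
      (Real.rpow_le_rpow_of_exponent_le hR (by gcongr))
  gcongr

theorem exists_norm_integral_prabhakarKernel_le {α β k D φ : ℝ} (hα : 0 ≤ α) (hβ : 0 ≤ β)
    (hD : 0 ≤ D) (hk : 0 ≤ k) (hk1 : k < 1) (h1 : Real.pi / 2 < |φ|) (h2 : |φ| < Real.pi) :
    ∃ M : ℝ, 0 ≤ M ∧ ∀ δ : ℝ, 0 ≤ δ → δ ≤ D → ∀ z : ℂ, z ≠ 0 →
      (∀ s ∈ sector |φ|, (z * s ^ ((-α : ℝ) : ℂ)).re ≤ k * ‖z * s ^ ((-α : ℝ) : ℂ)‖) →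
      ‖∫ r in Ioi 0, prabhakarKernel α β δ z (ray 1 φ r) * cexp (φ * I)‖ ≤
        M / (1 + ‖z‖ ^ δ) := by
  have hcos := cos_neg_of_abs h1 h2
  have hφ0 := ne_zero_of_abs h1
  have hs := abs_sin_pos hφ0 h2
  -- Half the decay rate: of `exp (-2br)`, one factor `exp (-br)` absorbs the polynomial growth and
  -- the other is integrated.
  set b := -Real.cos φ / 2 with hb
  have hb0 : 0 < b := by linarith
  obtain ⟨K, hK0, hK⟩ := exists_one_add_rpow_le_exp (mul_nonneg hα hD) hb0
  set A := Real.exp 1 * |Real.sin φ| ^ (-β) * √((1 - k) / 2) ^ (-D) * (1 + K) with hA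
  have hA0 : 0 ≤ A := by positivity
  have hint := exp_neg_integrableOn_Ioi 0 hb0
  refine ⟨A * ∫ r in Ioi 0, Real.exp (-b * r),
    mul_nonneg hA0 (integral_nonneg fun r => (Real.exp_pos _).le), fun δ hδ hδD z hz0 hz => ?_⟩
  rw [mul_div_right_comm, ← integral_const_mul]
  refine norm_integral_le_of_norm_le (hint.const_mul _) ?_
  filter_upwards [ae_restrict_mem measurableSet_Ioi] with r hr
  have hr0 : (0 : ℝ) ≤ r := le_of_lt hr
  have hw : 0 < 1 + ‖z‖ ^ δ := by positivity
  have hmem := ray_mem_sector hφ0 h2 one_pos.le hr0 (Or.inl one_pos)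
  have hle := norm_prabhakarKernel_le (β := β) hα hδ hδD hk hk1 hz0 hmem.1 (hz _ hmem)
    (by linarith : 1 ≤ 1 + r) (norm_ray_le one_pos.le hr0)
  rw [norm_mul, norm_exp_ofReal_mul_I, mul_one, div_mul_eq_mul_div, le_div_iff₀' hw]
  refine hle.trans ?_
  have h3 : ‖ray 1 φ r‖ ^ (-β) ≤ |Real.sin φ| ^ (-β) :=
    rpow_neg_le_of_le hs (by simpa using start_mul_abs_sin_le_norm_ray (c := 1) one_pos.le) hβ
  have h4 : 1 + (1 + r) ^ (α * D) ≤ (1 + K) * Real.exp (b * r) := by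
    have := Real.one_le_exp (mul_nonneg hb0.le hr0)
    linarith [hK r hr0]
  have h5 : Real.exp (ray 1 φ r).re = Real.exp 1 * Real.exp (-b * r) * Real.exp (-b * r) := by
    rw [ray_re, ← Real.exp_add, ← Real.exp_add]
    congr 1
    rw [hb]; ring
  have h6 : Real.exp (-b * r) * Real.exp (b * r) = 1 := by
    rw [← Real.exp_add, neg_mul, neg_add_cancel, Real.exp_zero]
  calc _ ≤ Real.exp 1 * Real.exp (-b * r) * Real.exp (-b * r) * |Real.sin φ| ^ (-β) *
        (√((1 - k) / 2) ^ (-D) * ((1 + K) * Real.exp (b * r))) := by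
        rw [h5]; gcongr
    _ = A * Real.exp (-b * r) * (Real.exp (-b * r) * Real.exp (b * r)) := by rw [hA]; ring
    _ = A * Real.exp (-b * r) := by rw [h6, mul_one]

theorem cos_le_cos_of_mem_Icc {x η : ℝ} (hη : 0 ≤ η) (h1 : η ≤ x) (h2 : x ≤ 2 * Real.pi - η) :
    Real.cos x ≤ Real.cos η := by
  by_cases h : x ≤ Real.pi
  · exact Real.cos_le_cos_of_nonneg_of_le_pi hη h h1
  · rw [← Real.cos_two_pi_sub x]
    exact Real.cos_le_cos_of_nonneg_of_le_pi hη (by linarith) (by linarith)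

/-- With `η = μ - αθ`, the argument `arg z - α arg s` has absolute value at least `η` and at most `π
+ αθ`, which is at most `2π - η` because `μ ≤ π`. -/
theorem re_mul_cpow_neg_le {α θ μ : ℝ} {z s : ℂ} (hα : 0 ≤ α) (hθμ : α * θ ≤ μ)
    (hμ : μ ≤ Real.pi) (hz0 : z ≠ 0) (hz : μ ≤ |arg z|) (hs : s ∈ sector θ) :
    (z * s ^ ((-α : ℝ) : ℂ)).re ≤ Real.cos (μ - α * θ) * ‖z * s ^ ((-α : ℝ) : ℂ)‖ := by
  have hexp : z * s ^ ((-α : ℝ) : ℂ) =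
      cexp (Complex.log z + Complex.log s * ((-α : ℝ) : ℂ)) := by
    rw [Complex.exp_add, exp_log hz0, cpow_def_of_ne_zero hs.1]
  have him : (Complex.log z + Complex.log s * ((-α : ℝ) : ℂ)).im = arg z - α * arg s := by
    simp [log_im]; ring
  rw [hexp, exp_re, norm_exp, him, mul_comm, ← Real.cos_abs]
  refine mul_le_mul_of_nonneg_right ?_ (Real.exp_pos _).le
  have h1 : |α * arg s| ≤ α * θ := by
    rw [abs_mul, abs_of_nonneg hα]
    exact mul_le_mul_of_nonneg_left hs.2 hα
  refine cos_le_cos_of_mem_Icc (by linarith) ?_ ?_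
  · linarith [abs_sub_abs_le_abs_sub (arg z) (α * arg s)]
  · linarith [abs_sub (arg z) (α * arg s), abs_arg_le_pi z]

theorem mainTheorem6 (α β μ D : ℝ) (hα : 0 < α) (hα2 : α < 2) (hβ : 0 < β)
    (hμ : α * Real.pi / 2 < μ) (hμ' : μ < min Real.pi (α * Real.pi)) :
    ∃ C : ℝ, 0 < C ∧ ∀ δ : ℝ, 0 < δ → δ ≤ D →
      ∀ z : ℂ, μ ≤ |Complex.arg z| → |Complex.arg z| ≤ Real.pi →
        ‖prabhakar α β δ z‖ ≤ C / (1 + ‖z‖ ^ δ) := by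
  rcases le_or_gt D 0 with hD | hD
  · exact ⟨1, one_pos, fun δ h1 h2 => absurd (h1.trans_le h2) hD.not_gt⟩
  obtain ⟨hμπ, -⟩ := lt_min_iff.1 hμ'
  have hπ := Real.pi_pos
  -- Such a `θ` exists because `μ > απ/2`.
  obtain ⟨θ, h1, hθ2⟩ := exists_between (a₁ := Real.pi / 2) (a₂ := min Real.pi (μ / α))
    (lt_min (by linarith) (by rw [lt_div_iff₀ hα]; linarith))
  obtain ⟨h2, h3⟩ := lt_min_iff.1 hθ2
  rw [lt_div_iff₀' hα] at h3
  have hμ0 : 0 < μ := lt_trans (by positivity) hμ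
  -- The cosine may be negative, while the estimates require `k ≥ 0`.
  set k := max 0 (Real.cos (μ - α * θ))
  have hk : 0 ≤ k := le_max_left _ _
  have hk1 : k < 1 := by
    refine max_lt one_pos ?_
    rw [← Real.cos_zero]
    exact Real.cos_lt_cos_of_nonneg_of_le_pi le_rfl (by nlinarith) (by linarith)
  have hθ : |θ| = θ := abs_of_pos ((half_pos hπ).trans h1)
  have hθ' : |-θ| = θ := by rw [abs_neg, hθ]
  obtain ⟨M, hM0, hM⟩ := exists_norm_integral_prabhakarKernel_le (φ := θ) hα.le hβ.le hD.le hk hk1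
    (by rwa [hθ]) (by rwa [hθ])
  obtain ⟨N, hN0, hN⟩ := exists_norm_integral_prabhakarKernel_le (φ := -θ) hα.le hβ.le hD.le hk hk1
    (by rwa [hθ']) (by rwa [hθ'])
  rw [hθ] at hM
  rw [hθ'] at hN
  refine ⟨(M + N + 1) / (2 * Real.pi), by positivity, fun δ hδ hδD z hz _ => ?_⟩
  have hz0 : z ≠ 0 := by
    rintro rfl
    rw [arg_zero, abs_zero] at hz
    linarith
  have hsec : ∀ s ∈ sector θ, (z * s ^ ((-α : ℝ) : ℂ)).re ≤ k * ‖z * s ^ ((-α : ℝ) : ℂ)‖ :=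
    fun s hs => (re_mul_cpow_neg_le hα.le h3.le hμπ.le hz0 hz hs).trans
      (mul_le_mul_of_nonneg_right (le_max_right _ _) (norm_nonneg _))
  have hrep := congrArg norm
    (hankelIntegral_prabhakarKernel (δ := δ) hα hβ hδ.le h1 h2 one_pos hk hk1 hsec)
  rw [norm_mul, norm_mul, norm_mul, norm_I, norm_ofNat, norm_real, Real.norm_of_nonneg hπ.le,
    mul_one] at hrep
  have hw : 0 < 1 + ‖z‖ ^ δ := by positivity
  have hle := (norm_sub_le _ _).trans
    (add_le_add (hM δ hδ.le hδD z hz0 hsec) (hN δ hδ.le hδD z hz0 hsec))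
  rw [← hankelIntegral, hrep, ← add_div, le_div_iff₀ hw] at hle
  rw [le_div_iff₀ hw, le_div_iff₀ (by positivity)]
  linarith
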